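/- Let $n\ge 4$, $\Delta>0$, and consider the $2n$ points of the plane $x_{1,i}=\left(-\frac{\Delta}{2},\frac{i-1}{n-1}\right)$ and $x_{2,i}=\left(\frac{\Delta}{2},\frac{i-1}{n-1}\right)$, $1\le i\le n$, which form two clusters $\Gamma_1=\{x_{1,i}\}_{i}$ and $\Gamma_2=\{x_{2,i}\}_{i}$ (two parallel unit segments at distance $\Delta$). Put $N=2n$, list the points as $x_1,\dots,x_N$, and regard $\Gamma_1,\Gamma_2$ as a partition of $\{1,\dots,N\}$. (a) Let $\gamma>0$ and let $w_{ij}=e^{-\|x_i-x_j\|^2/(2\sigma^2)}$, $1\le i,j\le N$, be the heat kernel weights with $$\sigma^2=\frac{\gamma}{(n-1)^2\log(n/\pi)}.$$ Let $W=(w_{ij})$, $d_i=\sum_j w_{ij}$, $D=\mathrm{diag}(d_1,\dots,d_N)$, $L=D-W$ and $L_{\mathrm{sym}}=I_N-D^{-1/2}WD^{-1/2}$. If $$\Delta\ \ge\ \frac{1}{n-1}\sqrt{1+\frac{6\gamma\log n}{\log(n/\pi)}},$$ then both semidefinite relaxations of spectral clustering recover the two lines exactly: - RatioCut-SDP: the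 program $\min\langle L,Z\rangle$ over symmetric $Z\in\mathbb{R}^{N\times N}$ with $Z\succeq 0$, $Z\ge 0$ entrywise, $\mathrm{Tr}(Z)=2$, $Z1_N=1_N$ has the unique minimizer $\sum_{a=1}^2\frac{1}{n}1_{\Gamma_a}1_{\Gamma_a}^\top$; - NCut-SDP: the program $\min\langle L_{\mathrm{sym}},Z\rangle$ over symmetric $Z\in\mathbb{R}^{N\times N}$ with $Z\succeq 0$, $Z\ge 0$ entrywise, $\mathrm{Tr}(Z)=2$, $ZD^{1/2}1_N=D^{1/2}1_N$ has the unique minimizer $\sum_{a=1}^2\frac{1}{1_{\Gamma_a}^\top D1_{\Gamma_a}}D^{1/2}1_{\Gamma_a}1_{\Gamma_a}^\top D^{1/2}$. (b) If $\Delta<\frac12$, then k-means with two centers fails: the objective $\Psi(c_1,c_2)=\sum_{i=1}^{N}\min_{a\in\{1,2\}}\|x_i-c_a\|^2$ attains its minimum over $c_1,c_2\in\mathbb{R}^2$, and for no minimizer $(c_1,c_2)$ does an assignment of every point to a nearest center give the partition $\{\Gamma_1,\Gamma_2\}$. -/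

import Mathlib

namespace SpectralSDP

noncomputable section

/-! ### Similarity graphs and graph Laplacians -/

/-- The heat kernel similarity matrix of a family of points `x` with bandwidth `σ`:
`w i j = exp (- ‖x i - x j‖ ^ 2 / (2 σ ^ 2))`. -/
def heatKernel {ι E : Type*} [NormedAddCommGroup E] (x : ι → E) (σ : ℝ) : Matrix ι ι ℝ :=
  Matrix.of fun i j => Real.exp (-(‖x i - x j‖ ^ 2) / (2 * σ ^ 2))

/-- The degree `d i = ∑ j, w i j` of a vertex. -/
def degree {ι : Type*} [Fintype ι] (W : Matrix ι ι ℝ) (i : ι) : ℝ :=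
  ∑ j, W i j

/-- The unnormalized graph Laplacian `L = D - W`. -/
def laplacian {ι : Type*} [Fintype ι] [DecidableEq ι] (W : Matrix ι ι ℝ) : Matrix ι ι ℝ :=
  Matrix.diagonal (degree W) - W

/-- The symmetric normalized graph Laplacian `L_sym = I - D^(-1/2) W D^(-1/2)`. -/
def symLaplacian {ι : Type*} [Fintype ι] [DecidableEq ι] (W : Matrix ι ι ℝ) : Matrix ι ι ℝ :=
  1 - Matrix.diagonal (fun i => (Real.sqrt (degree W i))⁻¹) * W *
    Matrix.diagonal (fun i => (Real.sqrt (degree W i))⁻¹)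

/-! ### Partition matrices: the partition is given by a labelling `lab : ι → κ` -/

/-- The cluster with label `a`. -/
def cluster {ι κ : Type*} [Fintype ι] [DecidableEq κ] (lab : ι → κ) (a : κ) : Finset ι :=
  Finset.univ.filter fun i => lab i = a

/-- `X_rcut = ∑ a, (1 / |Γ_a|) 1_{Γ_a} 1_{Γ_a}ᵀ`, written entrywise. -/
def ratioCutPartition {ι κ : Type*} [Fintype ι] [DecidableEq κ] (lab : ι → κ) :
    Matrix ι ι ℝ :=
  Matrix.of fun i j => if lab i = lab j then 1 / ((cluster lab (lab i)).card : ℝ) else 0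

/-- `X_ncut = ∑ a, (1 / (1_{Γ_a}ᵀ D 1_{Γ_a})) D^(1/2) 1_{Γ_a} 1_{Γ_a}ᵀ D^(1/2)`,
written entrywise. -/
def nCutPartition {ι κ : Type*} [Fintype ι] [DecidableEq κ] (W : Matrix ι ι ℝ) (lab : ι → κ) :
    Matrix ι ι ℝ :=
  Matrix.of fun i j =>
    if lab i = lab j then
      Real.sqrt (degree W i) * Real.sqrt (degree W j) / ∑ l ∈ cluster lab (lab i), degree W l
    else 0

/-! ### The semidefinite programs -/

/-- The feasible set `{Z ∈ S_N : Z ⪰ 0, Z ≥ 0 entrywise, Tr Z = k, Z φ = φ}`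
(symmetry of `Z` is part of `Matrix.PosSemidef`). -/
def sdpFeasible {ι : Type*} [Fintype ι] (k : ℕ) (φ : ι → ℝ) : Set (Matrix ι ι ℝ) :=
  {Z | Z.PosSemidef ∧ (∀ i j, 0 ≤ Z i j) ∧ Z.trace = (k : ℝ) ∧ Z.mulVec φ = φ}

/-- The inner product `⟨A, Z⟩ = Tr (Aᵀ Z)` of matrices. -/
def matInner {ι : Type*} [Fintype ι] (A Z : Matrix ι ι ℝ) : ℝ :=
  (A.transpose * Z).trace

/-- `X` is the unique global minimizer of `f` over `S`. -/
def IsUniqueMinimizer {α : Type*} (f : α → ℝ) (S : Set α) (X : α) : Prop :=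
  X ∈ S ∧ ∀ Z ∈ S, Z ≠ X → f X < f Z

/-- The RatioCut-SDP `min ⟨L, Z⟩` s.t. `Z ⪰ 0, Z ≥ 0, Tr Z = k, Z 1 = 1` for the similarity
matrix `W` recovers the partition given by `lab` exactly: its unique solution is `X_rcut`. -/
def RatioCutSDPRecovers {ι κ : Type*} [Fintype ι] [DecidableEq ι] [Fintype κ] [DecidableEq κ]
    (W : Matrix ι ι ℝ) (lab : ι → κ) : Prop :=
  IsUniqueMinimizer (matInner (laplacian W))
    (sdpFeasible (Fintype.card κ) (fun _ => 1)) (ratioCutPartition lab)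

/-- The NCut-SDP `min ⟨L_sym, Z⟩` s.t. `Z ⪰ 0, Z ≥ 0, Tr Z = k, Z D^(1/2) 1 = D^(1/2) 1` for the
similarity matrix `W` recovers the partition given by `lab` exactly: its unique solution is
`X_ncut`. -/
def NCutSDPRecovers {ι κ : Type*} [Fintype ι] [DecidableEq ι] [Fintype κ] [DecidableEq κ]
    (W : Matrix ι ι ℝ) (lab : ι → κ) : Prop :=
  IsUniqueMinimizer (matInner (symLaplacian W))
    (sdpFeasible (Fintype.card κ) (fun i => Real.sqrt (degree W i))) (nCutPartition W lab)

/-! ### k-means -/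

/-- The k-means objective `Ψ(c) = ∑ i, min_a ‖x i - c a‖ ^ 2` of a family of centers `c`. -/
def kMeansObjective {ι κ E : Type*} [Fintype ι] [NormedAddCommGroup E] (x : ι → E) (c : κ → E) :
    ℝ :=
  ∑ i, ⨅ a, ‖x i - c a‖ ^ 2

/-- `c` is a globally optimal family of centers. -/
def IsKMeansOptimal {ι κ E : Type*} [Fintype ι] [NormedAddCommGroup E] (x : ι → E) (c : κ → E) :
    Prop :=
  ∀ c' : κ → E, kMeansObjective x c ≤ kMeansObjective x c'

/-- `s` assigns every point to a nearest center. -/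
def IsNearestCenter {ι κ E : Type*} [NormedAddCommGroup E] (x : ι → E) (c : κ → E) (s : ι → κ) :
    Prop :=
  ∀ i a, ‖x i - c (s i)‖ ≤ ‖x i - c a‖

/-- Two labellings define the same partition. -/
def SamePartition {ι κ : Type*} (s lab : ι → κ) : Prop :=
  ∀ i j, s i = s j ↔ lab i = lab j

/-- k-means fails to recover the partition given by `lab`: optimal centers exist, and for no
choice of optimal centers and of nearest centers is the resulting partition that of `lab`. -/
def KMeansFails {ι κ E : Type*} [Fintype ι] [NormedAddCommGroup E] (x : ι → E) (lab : ι → κ) :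
    Prop :=
  (∃ c : κ → E, IsKMeansOptimal x c) ∧
    ∀ (c : κ → E) (s : ι → κ), IsKMeansOptimal x c → IsNearestCenter x c s → ¬ SamePartition s lab

/-! ### Two parallel lines -/

/-- `n` equispaced points on each of two parallel unit segments in the plane at distance `Δ`:
`(∓ Δ / 2, i / (n - 1))` for `i = 0, …, n - 1`. -/
def linePoint (n : ℕ) (Δ : ℝ) (p : Fin 2 × Fin n) : EuclideanSpace ℝ (Fin 2) :=
  !₂[if p.1 = 0 then -Δ / 2 else Δ / 2, (p.2.val : ℝ) / ((n : ℝ) - 1)]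

/-- The line on which a point lies. -/
def lineLabel (n : ℕ) (p : Fin 2 × Fin n) : Fin 2 := p.1

end

end SpectralSDP

namespace SpectralSDP

/-! A squared distance in the plane is a horizontal plus a vertical part, so the heat kernel matrix
is `[[K, τK], [τK, K]]`, with `K` the Gaussian kernel of one line and `τ = exp (-Δ² / (2σ²))`. Write
a feasible `Z` in blocks `A`, `B`, `Bᵀ`, `C`, and let `b ≥ 0` be the (weighted) mass of `B`. If `b =
0` then `Z` is the partition matrix, so it suffices that every feasible `Z` costs more than the
partition matrix by at least a positive multiple of `b`.

If the Laplacian of `K` has spectral gap `c`, pairing it with the positive semidefinite `A` and `C`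
gains a multiple of `c * b`, because the trace and fixed-vector constraints cancel everything except
`b`; the coupling loses at most a multiple of `τ * b`. RatioCut needs `3τ < c`. NCut needs `4τ < c`,
given that the degrees of `K` differ by at most a factor 2 (`ratioCut_unique_minimizer`,
`nCut_unique_minimizer`). A Poincaré inequality on the path gives `c = 6 exp (-r) / n³`, with `exp
(-r)` the weight of neighbours (`gaussianKernel_gap`), and the separation hypothesis says exactly
enough for `τ n³ ≤ exp (-r)` (`exp_separation_mul_cube_le`).

For k-means, splitting by lines costs at least the vertical variance of both lines, while the
centers `(0, 1/4)` and `(0, 3/4)` cost less when `Δ < 1/2` (`kMeansFails_linePoint`). -/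

open Finset Matrix

/-! ### Pairing quadratic forms with positive semidefinite matrices. -/

section PosSemidef

open scoped MatrixOrder

theorem exists_factor_of_posSemidef {ι : Type*} [Fintype ι] {Z : Matrix ι ι ℝ}
    (hZ : Z.PosSemidef) : ∃ V : Matrix ι ι ℝ, ∀ i j, Z i j = ∑ m, V m i * V m j := by
  classical
  have hV : (CFC.sqrt Z).PosSemidef := (CFC.sqrt_nonneg Z).posSemidef
  have hsq : CFC.sqrt Z * CFC.sqrt Z = Z := CFC.sqrt_mul_sqrt_self Z hZ.nonneg
  refine ⟨CFC.sqrt Z, fun i j => ?_⟩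
  conv_lhs => rw [← hsq]
  rw [Matrix.mul_apply]
  refine sum_congr rfl fun m _ => ?_
  rw [← hV.isHermitian.apply i m]
  simp

end PosSemidef

/-- A nonnegative quadratic form pairs nonnegatively with a positive semidefinite matrix. -/
theorem sum_mul_nonneg_of_posSemidef {ι : Type*} [Fintype ι] {Z : Matrix ι ι ℝ}
    (hZ : Z.PosSemidef) (M : ι → ι → ℝ)
    (hM : ∀ x : ι → ℝ, 0 ≤ ∑ i, ∑ j, M i j * (x i * x j)) :
    0 ≤ ∑ i, ∑ j, M i j * Z i j := by
  obtain ⟨V, hV⟩ := exists_factor_of_posSemidef hZ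
  have : ∑ i, ∑ j, M i j * Z i j = ∑ m, ∑ i, ∑ j, M i j * (V m i * V m j) := by
    simp_rw [hV, mul_sum]
    rw [sum_comm (s := univ (α := ι)) (f := fun m i => ∑ j, M i j * (V m i * V m j))]
    exact sum_congr rfl fun i _ => sum_comm
  rw [this]
  exact sum_nonneg fun m _ => hM _

theorem sum_sum_mul_sq_sub {ι : Type*} [Fintype ι] {K : Matrix ι ι ℝ}
    (hK : ∀ i j, K i j = K j i) (x : ι → ℝ) :
    ∑ i, ∑ j, K i j * (x i - x j) ^ 2 =
      2 * (∑ i, degree K i * x i ^ 2 - ∑ i, ∑ j, K i j * (x i * x j)) := by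
  have h1 : ∑ i, ∑ j, K i j * x i ^ 2 = ∑ i, degree K i * x i ^ 2 := by
    simp [degree, sum_mul]
  have h2 : ∑ i, ∑ j, K i j * x j ^ 2 = ∑ i, degree K i * x i ^ 2 := by
    rw [sum_comm, ← h1]
    exact sum_congr rfl fun i _ => sum_congr rfl fun j _ => by rw [hK]
  have h3 : ∑ i, ∑ j, K i j * (x i - x j) ^ 2 =
      ∑ i, ∑ j, K i j * x i ^ 2 + ∑ i, ∑ j, K i j * x j ^ 2
        - 2 * ∑ i, ∑ j, K i j * (x i * x j) := by
    simp_rw [mul_sum, ← sum_add_distrib, ← sum_sub_distrib]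
    exact sum_congr rfl fun i _ => sum_congr rfl fun j _ => by ring
  rw [h3, h1, h2]; ring

theorem sum_sum_weighted_sq_sub {ι : Type*} [Fintype ι] (w x : ι → ℝ) :
    ∑ i, ∑ j, w i * w j * (x i - x j) ^ 2 =
      2 * ((∑ i, w i) * ∑ i, w i * x i ^ 2 - (∑ i, w i * x i) ^ 2) := by
  rw [sum_sum_mul_sq_sub (K := fun i j => w i * w j) (fun i j => mul_comm _ _) x]
  congr 2
  · rw [mul_sum]
    refine sum_congr rfl fun i _ => ?_
    change (∑ j, w i * w j) * x i ^ 2 = _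
    rw [← mul_sum]; ring
  · rw [sq, sum_mul_sum]
    exact sum_congr rfl fun i _ => sum_congr rfl fun j _ => by ring

/-- The spectral gap of a graph Laplacian, paired with a positive semidefinite matrix. -/
theorem laplacian_gap_posSemidef {ι : Type*} [Fintype ι] {K A : Matrix ι ι ℝ} {w : ι → ℝ}
    {ψ : ι → ℝ} (hψ : ∀ i, 0 < ψ i) (hw : ∀ i, w i = ψ i ^ 2)
    (hK : ∀ i j, K i j = K j i) {c : ℝ}
    (hgap : ∀ y : ι → ℝ, c * ∑ i, ∑ j, w i * w j * (y i - y j) ^ 2 ≤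
      ∑ i, ∑ j, K i j * (y i - y j) ^ 2) (hA : A.PosSemidef) :
    c * ((∑ i, w i) * ∑ i, A i i - ∑ i, ∑ j, ψ i * ψ j * A i j) ≤
      ∑ i, degree K i / w i * A i i - ∑ i, ∑ j, K i j / (ψ i * ψ j) * A i j := by
  classical
  -- This is the Laplacian of `K` minus `c` times the Laplacian of the weights `w i * w j`,
  -- conjugated by `diag(ψ)⁻¹`; it is nonnegative by `hgap` at `y = x / ψ`.
  have key := sum_mul_nonneg_of_posSemidef hA
    (fun i j => (if i = j then degree K i / w i - c * ∑ l, w l else 0)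
      - K i j / (ψ i * ψ j) + c * (ψ i * ψ j)) ?_
  · simp only [add_mul, sub_mul, ite_mul, zero_mul, sum_add_distrib, sum_sub_distrib,
      sum_ite_eq, mem_univ, if_true] at key
    simp only [mul_assoc, ← mul_sum] at key ⊢
    linarith
  · intro x
    have h := hgap fun i => x i / ψ i
    rw [sum_sum_mul_sq_sub hK, sum_sum_weighted_sq_sub] at h
    have e1 : ∑ i, degree K i * (x i / ψ i) ^ 2 = ∑ i, degree K i / w i * (x i * x i) :=
      sum_congr rfl fun i _ => by rw [hw]; ring
    have e2 : ∑ i, ∑ j, K i j * (x i / ψ i * (x j / ψ j)) =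
        ∑ i, ∑ j, K i j / (ψ i * ψ j) * (x i * x j) :=
      sum_congr rfl fun i _ => sum_congr rfl fun j _ => by
        have := (hψ i).ne'; have := (hψ j).ne'; field_simp
    have e3 : ∑ i, w i * (x i / ψ i) ^ 2 = ∑ i, x i * x i :=
      sum_congr rfl fun i _ => by have := (hψ i).ne'; rw [hw]; field_simp
    have e4 : (∑ i, w i * (x i / ψ i)) ^ 2 = ∑ i, ∑ j, ψ i * ψ j * (x i * x j) := by
      rw [sq, sum_mul_sum]
      refine sum_congr rfl fun i _ => sum_congr rfl fun j _ => ?_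
      have := (hψ i).ne'; have := (hψ j).ne'; rw [hw, hw]; field_simp
    rw [e1, e2, e3, e4] at h
    simp only [add_mul, sub_mul, ite_mul, zero_mul, sum_add_distrib, sum_sub_distrib,
      sum_ite_eq, mem_univ, if_true]
    simp only [mul_assoc, ← mul_sum] at h ⊢
    linarith

/-- Nonnegativity of `⟨(I - J) diag(k) (I - J), A⟩`, where `J` is the averaging projection. -/
theorem sum_diag_mul_ge_of_posSemidef {ι : Type*} [Fintype ι] [Nonempty ι] {A : Matrix ι ι ℝ}
    (hA : A.PosSemidef) {k : ι → ℝ} (hk : ∀ i, 0 ≤ k i) :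
    2 / (Fintype.card ι : ℝ) * ∑ i, k i * ∑ j, A i j
      - (∑ i, k i) / (Fintype.card ι : ℝ) ^ 2 * ∑ i, ∑ j, A i j ≤ ∑ i, k i * A i i := by
  classical
  set N : ℝ := (Fintype.card ι : ℝ) with hN
  have hN0 : N ≠ 0 := by simp [hN]
  -- The two cross terms of `(I - J) diag(k) (I - J)` are merged into the unsymmetric `2 / N * k i`;
  -- only the quadratic form matters.
  have key := sum_mul_nonneg_of_posSemidef hA
    (fun i j => (if i = j then k i else 0) - 2 / N * k i + (∑ l, k l) / N ^ 2) ?_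
  · simp only [add_mul, sub_mul, ite_mul, zero_mul, sum_add_distrib, sum_sub_distrib,
      sum_ite_eq, mem_univ, if_true] at key
    simp only [mul_assoc, ← mul_sum] at key ⊢
    linarith
  · intro x
    have h : 0 ≤ ∑ i, k i * (x i - (∑ j, x j) / N) ^ 2 :=
      sum_nonneg fun i _ => mul_nonneg (hk i) (sq_nonneg _)
    have e : ∑ i, k i * (x i - (∑ j, x j) / N) ^ 2 = ∑ i, k i * (x i * x i)
        - 2 / N * ((∑ i, k i * x i) * ∑ j, x j) + (∑ i, k i) / N ^ 2 * ((∑ j, x j) * ∑ j, x j) := by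
      generalize ∑ j, x j = T
      rw [sum_mul (f := fun i => k i * x i), mul_sum, sum_div, sum_mul, ← sum_sub_distrib,
        ← sum_add_distrib]
      exact sum_congr rfl fun i _ => by field_simp; ring
    rw [e] at h
    simp only [add_mul, sub_mul, ite_mul, zero_mul, sum_add_distrib, sum_sub_distrib,
      sum_ite_eq, mem_univ, if_true]
    simp only [mul_assoc, ← mul_sum, ← sum_mul] at h ⊢
    have e' : ∑ i, k i * (x i * ∑ j, x j) = (∑ i, k i * x i) * ∑ j, x j := by
      rw [sum_mul]; exact sum_congr rfl fun i _ => by ring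
    rw [e']
    linarith

/-! ### The partition matrix as a projection, and its characterization among feasible matrices. -/

section TwoBlocks

variable {ι : Type*} [Fintype ι]

/-- The orthogonal projection onto the span of the two copies of `ψ`. -/
noncomputable def blockProjection (ψ : ι → ℝ) : Matrix (Fin 2 × ι) (Fin 2 × ι) ℝ :=
  Matrix.of fun p q => if p.1 = q.1 then ψ p.2 * ψ q.2 / ∑ l, ψ l ^ 2 else 0

theorem blockProjection_transpose (ψ : ι → ℝ) :
    (blockProjection ψ).conjTranspose = blockProjection ψ := by
  ext p q
  simp only [blockProjection, conjTranspose_apply, of_apply, star_trivial, eq_comm (a := q.1),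
    mul_comm (ψ q.2)]

/-- By `hZ`, `Z` fixes each copy of `ψ` supported on one block, and the columns of the projection
are multiples of these copies. -/
theorem mul_blockProjection_self (ψ : ι → ℝ) {Z : Matrix (Fin 2 × ι) (Fin 2 × ι) ℝ}
    (hZ : ∀ p a, ∑ l, Z p (a, l) * ψ l = if p.1 = a then ψ p.2 else 0) :
    Z * blockProjection ψ = blockProjection ψ := by
  ext p q
  have h : ∀ a, ∑ l, Z p (a, l) * blockProjection ψ (a, l) q =
      if a = q.1 then (if p.1 = a then ψ p.2 else 0) * (ψ q.2 / ∑ l, ψ l ^ 2) else 0 := by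
    intro a
    rw [← hZ, sum_mul]
    split_ifs with h
    · exact sum_congr rfl fun l _ => by simp only [blockProjection, of_apply, if_pos h]; ring
    · exact sum_eq_zero fun l _ => by simp only [blockProjection, of_apply, if_neg h, mul_zero]
  rw [mul_apply, Fintype.sum_prod_type]
  simp_rw [h, sum_ite_eq', mem_univ, if_true]
  simp only [blockProjection, of_apply]
  split_ifs <;> ring

variable {ψ : ι → ℝ} (hS : 0 < ∑ l, ψ l ^ 2)
include hS

theorem blockProjection_sum_mul (p : Fin 2 × ι) (a : Fin 2) :
    ∑ l, blockProjection ψ p (a, l) * ψ l = if p.1 = a then ψ p.2 else 0 := by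
  simp only [blockProjection, of_apply]
  split_ifs with h
  · have : ∀ l, ψ p.2 * ψ l / (∑ l, ψ l ^ 2) * ψ l = ψ p.2 / (∑ l, ψ l ^ 2) * ψ l ^ 2 :=
      fun l => by ring
    simp_rw [this]
    rw [← mul_sum, div_mul_cancel₀ _ hS.ne']
  · simp

theorem trace_blockProjection : (blockProjection ψ).trace = 2 := by
  have : ∀ l, ψ l * ψ l / ∑ l, ψ l ^ 2 = ψ l ^ 2 / ∑ l, ψ l ^ 2 := fun l => by ring
  simp [trace, blockProjection, Fintype.sum_prod_type, this, ← sum_div]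
  field_simp

theorem blockProjection_mem_sdpFeasible (hψ : ∀ i, 0 ≤ ψ i) :
    blockProjection ψ ∈ sdpFeasible 2 (fun p : Fin 2 × ι => ψ p.2) := by
  refine ⟨?_, fun p q => ?_, by simpa using trace_blockProjection hS, ?_⟩
  · have h := posSemidef_conjTranspose_mul_self (blockProjection ψ)
    rwa [blockProjection_transpose,
      mul_blockProjection_self ψ (blockProjection_sum_mul hS)] at h
  · simp only [blockProjection, of_apply]
    split_ifs
    · exact div_nonneg (mul_nonneg (hψ _) (hψ _)) hS.le
    · exact le_rfl
  · ext p
    simp [mulVec, dotProduct, Fintype.sum_prod_type,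
      blockProjection_sum_mul hS]

/-- A feasible matrix whose off-diagonal blocks vanish is the partition matrix. -/
theorem eq_blockProjection_of_mem_sdpFeasible {Z : Matrix (Fin 2 × ι) (Fin 2 × ι) ℝ}
    (hZ : Z ∈ sdpFeasible 2 (fun p : Fin 2 × ι => ψ p.2))
    (hB : ∀ i j, Z (0, i) (1, j) = 0) : Z = blockProjection ψ := by
  classical
  obtain ⟨hpsd, -, htr, hfix⟩ := hZ
  have hB' : ∀ i j, Z (1, i) (0, j) = 0 := fun i j => by
    rw [← hpsd.isHermitian.apply, hB, star_zero]
  have hfix' : ∀ p, ∑ l, Z p (0, l) * ψ l + ∑ l, Z p (1, l) * ψ l = ψ p.2 := fun p => by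
    have := congrFun hfix p
    simpa [mulVec, dotProduct, Fintype.sum_prod_type] using this
  have hmul : Z * blockProjection ψ = blockProjection ψ := by
    refine mul_blockProjection_self ψ fun p a => ?_
    obtain ⟨b, i⟩ := p
    have := hfix' (b, i)
    fin_cases b <;> fin_cases a <;> simp_all
  have hmul' : blockProjection ψ * Z = blockProjection ψ := by
    have := congrArg conjTranspose hmul
    rwa [conjTranspose_mul, blockProjection_transpose, hpsd.isHermitian.eq] at this
  have hidem := mul_blockProjection_self ψ (blockProjection_sum_mul hS)
  -- With `P` the projection, `(1 - P) Z (1 - P) = Z - P` is positive semidefinite of trace `2 - 2 =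
  -- 0`, hence zero.
  have h := hpsd.mul_mul_conjTranspose_same (1 - blockProjection ψ)
  have e : (1 - blockProjection ψ) * Z * (1 - blockProjection ψ).conjTranspose =
      Z - blockProjection ψ := by
    rw [conjTranspose_sub, conjTranspose_one, blockProjection_transpose]
    simp [sub_mul, mul_sub, hmul, hmul', hidem]
  rw [e] at h
  refine sub_eq_zero.mp (h.trace_eq_zero_iff.mp ?_)
  rw [trace_sub, htr, trace_blockProjection hS]; simp

end TwoBlocks

/-! ### Objectives in block form and the two recovery criteria. -/

theorem matInner_eq_sum {ι : Type*} [Fintype ι] (A Z : Matrix ι ι ℝ) :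
    matInner A Z = ∑ i, ∑ j, A i j * Z i j := by
  rw [sum_comm]
  simp [matInner, trace, mul_apply]

theorem matInner_laplacian {ι : Type*} [Fintype ι] [DecidableEq ι] (W Z : Matrix ι ι ℝ) :
    matInner (laplacian W) Z = ∑ i, degree W i * Z i i - ∑ i, ∑ j, W i j * Z i j := by
  simp [matInner_eq_sum, laplacian, sub_mul, sum_sub_distrib, diagonal_apply, ite_mul]

theorem matInner_symLaplacian {ι : Type*} [Fintype ι] [DecidableEq ι] (W Z : Matrix ι ι ℝ) :
    matInner (symLaplacian W) Z =
      Z.trace - ∑ i, ∑ j, W i j / (√(degree W i) * √(degree W j)) * Z i j := by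
  have : ∀ i j, (√(degree W i))⁻¹ * W i j * (√(degree W j))⁻¹ =
      W i j / (√(degree W i) * √(degree W j)) := fun i j => by
    rw [div_eq_mul_inv, mul_inv]; ring
  simp [matInner_eq_sum, symLaplacian, sub_mul, sum_sub_distrib, one_apply, ite_mul, trace, this]

theorem sum_sum_prod_two {ι : Type*} [Fintype ι] (f : Fin 2 × ι → Fin 2 × ι → ℝ)
    (hf : ∀ p q, f p q = f q p) :
    ∑ p, ∑ q, f p q = ∑ i, ∑ j, f (0, i) (0, j) + ∑ i, ∑ j, f (1, i) (1, j)
      + 2 * ∑ i, ∑ j, f (0, i) (1, j) := by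
  have h : ∑ i, ∑ j, f (1, i) (0, j) = ∑ i, ∑ j, f (0, i) (1, j) := by
    rw [sum_comm]; exact sum_congr rfl fun i _ => sum_congr rfl fun j _ => hf _ _
  simp only [Fintype.sum_prod_type, Fin.sum_univ_two, sum_add_distrib, h]
  ring

section Recovery

variable {ι : Type*} [Fintype ι]

theorem block_row_sum {ψ : ι → ℝ} {Z : Matrix (Fin 2 × ι) (Fin 2 × ι) ℝ}
    (hZ : Z ∈ sdpFeasible 2 (fun p : Fin 2 × ι => ψ p.2)) (p : Fin 2 × ι) :
    ∑ l, Z p (0, l) * ψ l + ∑ l, Z p (1, l) * ψ l = ψ p.2 := by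
  have := congrFun hZ.2.2.2 p
  simpa [mulVec, dotProduct, Fintype.sum_prod_type] using this

/-- The constraint `Z φ = φ` trades diagonal-block sums for off-diagonal mass, the quantity in which
all bounds are expressed. In `Fin 2`, `1 - a` is the other block. -/
theorem block_sum_eq {ψ : ι → ℝ} {Z : Matrix (Fin 2 × ι) (Fin 2 × ι) ℝ}
    (hZ : Z ∈ sdpFeasible 2 (fun p : Fin 2 × ι => ψ p.2)) (w : ι → ℝ) (a : Fin 2) :
    ∑ i, ∑ j, w i * ψ j * Z (a, i) (a, j) =
      ∑ i, w i * ψ i - ∑ i, ∑ j, w i * ψ j * Z (a, i) (1 - a, j) := by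
  rw [← sum_sub_distrib]
  refine sum_congr rfl fun i _ => ?_
  have h := block_row_sum hZ (a, i)
  have h1 : ∀ p a, ∑ l, w i * ψ l * Z p (a, l) = w i * ∑ l, Z p (a, l) * ψ l := fun p a => by
    rw [mul_sum]; exact sum_congr rfl fun l _ => by ring
  rw [h1, h1, ← mul_sub]
  congr 1
  obtain rfl | rfl : a = 0 ∨ a = 1 := by omega
  · rw [sub_zero]; exact eq_sub_of_add_eq h
  · rw [sub_self]; exact eq_sub_of_add_eq' h

theorem trace_blocks {Z : Matrix (Fin 2 × ι) (Fin 2 × ι) ℝ} (h : Z.trace = 2) :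
    ∑ i, Z (0, i) (0, i) + ∑ i, Z (1, i) (1, i) = 2 := by
  rw [← h]; simp [trace, Fintype.sum_prod_type]

theorem eq_blockProjection_of_sum_eq_zero {ψ : ι → ℝ} (hψ : ∀ i, 0 < ψ i)
    (hS : 0 < ∑ l, ψ l ^ 2) {Z : Matrix (Fin 2 × ι) (Fin 2 × ι) ℝ}
    (hZ : Z ∈ sdpFeasible 2 (fun p : Fin 2 × ι => ψ p.2))
    (hb : ∑ i, ∑ j, ψ i * ψ j * Z (0, i) (1, j) = 0) : Z = blockProjection ψ := by
  have hnn : ∀ i j, 0 ≤ ψ i * ψ j * Z (0, i) (1, j) := fun i j =>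
    mul_nonneg (mul_pos (hψ i) (hψ j)).le (hZ.2.1 _ _)
  refine eq_blockProjection_of_mem_sdpFeasible hS hZ fun i j => ?_
  have h1 := (sum_eq_zero_iff_of_nonneg fun i _ => sum_nonneg fun j _ => hnn i j).mp hb i
    (mem_univ _)
  have h2 := (sum_eq_zero_iff_of_nonneg fun j _ => hnn i j).mp h1 j (mem_univ _)
  exact (mul_eq_zero.mp h2).resolve_left (mul_pos (hψ i) (hψ j)).ne'

variable {K : Matrix ι ι ℝ} {W : Matrix (Fin 2 × ι) (Fin 2 × ι) ℝ} {τ c : ℝ}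

theorem degree_two_block (hW : ∀ p q, W p q = (if p.1 = q.1 then 1 else τ) * K p.2 q.2)
    (p : Fin 2 × ι) : degree W p = (1 + τ) * degree K p.2 := by
  obtain ⟨a, i⟩ := p
  simp only [degree, hW, Fintype.sum_prod_type, Fin.sum_univ_two, mul_sum, add_mul, sum_add_distrib]
  fin_cases a <;> simp [add_comm]

variable [DecidableEq ι]

/-- Objective values of the RatioCut relaxation, block by block. -/
theorem matInner_laplacian_two_block
    (hW : ∀ p q, W p q = (if p.1 = q.1 then 1 else τ) * K p.2 q.2)
    (hK : ∀ i j, K i j = K j i) {Z : Matrix (Fin 2 × ι) (Fin 2 × ι) ℝ}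
    (hZ : ∀ p q, Z p q = Z q p) :
    matInner (laplacian W) Z =
      (1 + τ) * (∑ i, degree K i * Z (0, i) (0, i) + ∑ i, degree K i * Z (1, i) (1, i))
      - (∑ i, ∑ j, K i j * Z (0, i) (0, j) + ∑ i, ∑ j, K i j * Z (1, i) (1, j)
      + 2 * (τ * ∑ i, ∑ j, K i j * Z (0, i) (1, j))) := by
  rw [matInner_laplacian, sum_sum_prod_two]
  · simp only [degree_two_block hW, Fintype.sum_prod_type, Fin.sum_univ_two, mul_add, mul_sum,
      hW, if_true, one_mul, mul_assoc]
    simp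
  · intro p q
    rw [hW, hW, hZ p q, hK p.2, if_congr eq_comm rfl rfl]

theorem matInner_symLaplacian_two_block
    (hW : ∀ p q, W p q = (if p.1 = q.1 then 1 else τ) * K p.2 q.2)
    (hK : ∀ i j, K i j = K j i) {ψ : ι → ℝ} (hψ : ∀ p, √(degree W p) = ψ p.2)
    {Z : Matrix (Fin 2 × ι) (Fin 2 × ι) ℝ} (hZ : ∀ p q, Z p q = Z q p) :
    matInner (symLaplacian W) Z =
      Z.trace - (∑ i, ∑ j, K i j / (ψ i * ψ j) * Z (0, i) (0, j)
        + ∑ i, ∑ j, K i j / (ψ i * ψ j) * Z (1, i) (1, j)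
      + 2 * (τ * ∑ i, ∑ j, K i j / (ψ i * ψ j) * Z (0, i) (1, j))) := by
  rw [matInner_symLaplacian, sum_sum_prod_two]
  · simp only [hψ, hW, if_true, one_mul, mul_assoc, mul_sum, mul_div_assoc]
    simp
  · intro p q
    rw [hW, hW, hZ p q, hK p.2, if_congr eq_comm rfl rfl, mul_comm (√_)]

/-- The gap terms of `A` and `C` add up to `2 * c * b`. The diagonal terms carrying `τ` lose at most
`2 * τ * b` per block and the coupling with `B` another `2 * τ * b`, so the excess is at least `2 *
(c - 3 * τ) * b`. -/
theorem ratioCut_unique_minimizer [Nonempty ι]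
    (hW : ∀ p q, W p q = (if p.1 = q.1 then 1 else τ) * K p.2 q.2)
    (hK : ∀ i j, K i j = K j i) (hK0 : ∀ i j, 0 ≤ K i j) (hK1 : ∀ i j, K i j ≤ 1)
    (hτ : 0 ≤ τ) (hc : 3 * τ < c)
    (hgap : ∀ y : ι → ℝ, c * ∑ i, ∑ j, (y i - y j) ^ 2 ≤ ∑ i, ∑ j, K i j * (y i - y j) ^ 2) :
    IsUniqueMinimizer (matInner (laplacian W)) (sdpFeasible 2 (fun _ => 1))
      (blockProjection (fun _ : ι => 1)) := by
  set N : ℝ := (Fintype.card ι : ℝ) with hN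
  have hN0 : 0 < N := by rw [hN]; exact_mod_cast Fintype.card_pos
  have hS : (0 : ℝ) < ∑ _l : ι, 1 ^ 2 := by simpa [hN] using hN0
  have hX := blockProjection_mem_sdpFeasible hS (fun _ => zero_le_one)
  refine ⟨hX, fun Z hZ hne => ?_⟩
  have hsymm : ∀ {Y : Matrix (Fin 2 × ι) (Fin 2 × ι) ℝ}, Y.PosSemidef → ∀ p q, Y p q = Y q p :=
    fun h p q => by simpa using h.isHermitian.apply q p
  have hk0 : ∀ i, 0 ≤ degree K i := fun i => sum_nonneg fun j _ => hK0 i j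
  have hkN : ∀ i, degree K i ≤ N := fun i => by
    simpa [hN, degree] using sum_le_sum fun j (_ : j ∈ univ) => hK1 i j
  set S := ∑ i, degree K i with hSdef
  have hval : matInner (laplacian W) (blockProjection (fun _ : ι => 1)) = 2 * τ * S / N := by
    rw [matInner_laplacian_two_block hW hK (hsymm hX.1)]
    simp only [blockProjection, of_apply, if_true, one_pow, sum_const, card_univ,
      nsmul_eq_mul, mul_one, ← hN, ← sum_mul, ← hSdef]
    have : ∑ i, ∑ j, K i j = S := rfl
    simp [this]
    ring
  set b := ∑ i, ∑ j, Z (0, i) (1, j) with hb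
  have hb0 : 0 ≤ b := sum_nonneg fun i _ => sum_nonneg fun j _ => hZ.2.1 _ _
  have hbpos : 0 < b := by
    refine lt_of_le_of_ne hb0 fun h => hne ?_
    refine eq_blockProjection_of_sum_eq_zero (fun _ => one_pos) hS hZ ?_
    simpa using h.symm
  have hbT : ∑ i, ∑ j, Z (1, i) (0, j) = b := by
    rw [hb, sum_comm]
    exact sum_congr rfl fun i _ => sum_congr rfl fun j _ => hsymm hZ.1 _ _
  have htr := trace_blocks (by simpa using hZ.2.2.1)
  have hA : (Z.submatrix (Prod.mk 0) (Prod.mk 0) : Matrix ι ι ℝ).PosSemidef := hZ.1.submatrix _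
  have hC : (Z.submatrix (Prod.mk 1) (Prod.mk 1) : Matrix ι ι ℝ).PosSemidef := hZ.1.submatrix _
  have hgap' : ∀ y : ι → ℝ, c * ∑ i, ∑ j, (1 : ℝ) * 1 * (y i - y j) ^ 2 ≤
      ∑ i, ∑ j, K i j * (y i - y j) ^ 2 := by simpa using hgap
  have gA := laplacian_gap_posSemidef (w := fun _ => 1) (ψ := fun _ => 1) (fun _ => one_pos)
    (fun _ => (one_pow 2).symm) hK hgap' hA
  have gC := laplacian_gap_posSemidef (w := fun _ => 1) (ψ := fun _ => 1) (fun _ => one_pos)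
    (fun _ => (one_pow 2).symm) hK hgap' hC
  have dA := sum_diag_mul_ge_of_posSemidef hA hk0
  have dC := sum_diag_mul_ge_of_posSemidef hC hk0
  have sA := block_sum_eq (ψ := fun _ => 1) hZ (fun _ => 1) 0
  have sC := block_sum_eq (ψ := fun _ => 1) hZ (fun _ => 1) 1
  have kA := block_sum_eq (ψ := fun _ => 1) hZ (degree K) 0
  have kC := block_sum_eq (ψ := fun _ => 1) hZ (degree K) 1
  have hle : ∀ a a' : Fin 2, ∑ i, ∑ j, degree K i * Z (a, i) (a', j) ≤
      N * ∑ i, ∑ j, Z (a, i) (a', j) := fun a a' => by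
    simp_rw [mul_sum]
    exact sum_le_sum fun i _ => sum_le_sum fun j _ =>
      mul_le_mul_of_nonneg_right (hkN i) (hZ.2.1 _ _)
  have kA' := hle 0 1
  have kC' := hle 1 0
  have hKB : ∑ i, ∑ j, K i j * Z (0, i) (1, j) ≤ b :=
    sum_le_sum fun i _ => sum_le_sum fun j _ => mul_le_of_le_one_left (hZ.2.1 _ _) (hK1 i j)
  simp only [submatrix_apply, div_one, mul_one, one_mul, sum_const, card_univ, nsmul_eq_mul,
    ← hN, ← hSdef, sub_zero, sub_self, ← hb, hbT, ← mul_sum] at gA gC dA dC sA sC kA kC kA' kC'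
  simp only [mul_sum] at kA kC dA dC
  simp only [← mul_sum] at kA kC dA dC
  rw [hval, matInner_laplacian_two_block hW hK (hsymm hZ.1)]
  rw [kA, sA] at dA
  rw [kC, sC] at dC
  -- Here `x` is the degree-weighted off-diagonal mass; the term `S / N ^ 2 * b` is nonnegative and
  -- is dropped.
  have hbound : ∀ {x D : ℝ}, x ≤ N * b → 2 / N * (S - x) - S / N ^ 2 * (N - b) ≤ D →
      S / N - 2 * b ≤ D := fun {x D} hx hD => by
    refine le_trans ?_ hD
    have h1 : x / N ≤ b := (div_le_iff₀' hN0).2 hx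
    have h2 : 0 ≤ S / N ^ 2 * b :=
      mul_nonneg (div_nonneg (sum_nonneg fun i _ => hk0 i) (sq_nonneg _)) hb0
    have h3 : 2 / N * (S - x) - S / N ^ 2 * (N - b) =
        S / N - 2 * (x / N) + S / N ^ 2 * b := by field_simp; ring
    linarith
  have dA' := mul_le_mul_of_nonneg_left (hbound kA' dA) hτ
  have dC' := mul_le_mul_of_nonneg_left (hbound kC' dC) hτ
  have hB' := mul_le_mul_of_nonneg_left hKB hτ
  rw [sA] at gA
  rw [sC, eq_sub_of_add_eq' htr] at gC
  have hpos := mul_pos (sub_pos.mpr hc) hbpos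
  have hdiv : 2 * τ * S / N = 2 * (τ * (S / N)) := by ring
  rw [hdiv]
  linarith

/-- Degrees of `W` are proportional to those of `K`, so the normalized diagonal is the constant `1 /
s` and contributes only through the trace. The excess is at least `(c / 2 - 2 * τ) * M * b`. -/
theorem nCut_unique_minimizer [Nonempty ι]
    (hW : ∀ p q, W p q = (if p.1 = q.1 then 1 else τ) * K p.2 q.2)
    (hK : ∀ i j, K i j = K j i) (hK1 : ∀ i j, K i j ≤ 1)
    (hτ : 0 ≤ τ) (hc : 4 * τ < c) {κ : ℝ} (hκ : 0 < κ) (hκK : ∀ i, κ ≤ degree K i)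
    (hKκ : ∀ i, degree K i ≤ 2 * κ)
    (hgap : ∀ y : ι → ℝ, c * ∑ i, ∑ j, (y i - y j) ^ 2 ≤ ∑ i, ∑ j, K i j * (y i - y j) ^ 2) :
    IsUniqueMinimizer (matInner (symLaplacian W)) (sdpFeasible 2 (fun p => √(degree W p)))
      (blockProjection (fun i => √((1 + τ) * degree K i))) := by
  set s : ℝ := 1 + τ with hs
  have hs0 : 0 < s := by positivity
  set w : ι → ℝ := fun i => s * degree K i with hw
  set ψ : ι → ℝ := fun i => √(s * degree K i) with hψdef
  have hk0 : ∀ i, 0 < degree K i := fun i => hκ.trans_le (hκK i)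
  have hw0 : ∀ i, 0 < w i := fun i => mul_pos hs0 (hk0 i)
  have hψ : ∀ i, 0 < ψ i := fun i => Real.sqrt_pos.2 (hw0 i)
  have hwψ : ∀ i, w i = ψ i ^ 2 := fun i => (Real.sq_sqrt (hw0 i).le).symm
  have hφ : ∀ p, √(degree W p) = ψ p.2 := fun p => by rw [degree_two_block hW]
  have hφ' : (fun p => √(degree W p)) = fun p : Fin 2 × ι => ψ p.2 := funext hφ
  rw [hφ']
  have hS : 0 < ∑ l, ψ l ^ 2 := sum_pos (fun i _ => pow_pos (hψ i) 2) univ_nonempty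
  set S := ∑ l, ψ l ^ 2 with hSdef
  have hX := blockProjection_mem_sdpFeasible hS (fun i => (hψ i).le)
  refine ⟨hX, fun Z hZ hne => ?_⟩
  have hsymm : ∀ {Y : Matrix (Fin 2 × ι) (Fin 2 × ι) ℝ}, Y.PosSemidef → ∀ p q, Y p q = Y q p :=
    fun h p q => by simpa using h.isHermitian.apply q p
  have hSK : S = s * ∑ i, degree K i := by
    rw [mul_sum]; exact sum_congr rfl fun i _ => (hwψ i).symm
  have hval : matInner (symLaplacian W) (blockProjection ψ) = 2 - 2 / s := by
    rw [matInner_symLaplacian_two_block hW hK hφ (hsymm hX.1), trace_blockProjection hS]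
    have h1 : ∀ i j, K i j / (ψ i * ψ j) * (ψ i * ψ j / S) = K i j / S := fun i j => by
      have := (hψ i).ne'; have := (hψ j).ne'; field_simp
    have h2 : ∑ i, ∑ j, K i j / S = 1 / s := by
      simp_rw [← sum_div]
      change (∑ i, degree K i) / S = 1 / s
      have hSK' : 0 < ∑ i, degree K i := sum_pos (fun i _ => hk0 i) univ_nonempty
      rw [hSK]
      field_simp
    simp only [blockProjection, of_apply, if_true, ← hSdef, h1, h2]
    simp
    ring
  set b := ∑ i, ∑ j, ψ i * ψ j * Z (0, i) (1, j) with hb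
  have hb0 : 0 ≤ b := sum_nonneg fun i _ => sum_nonneg fun j _ =>
    mul_nonneg (mul_pos (hψ i) (hψ j)).le (hZ.2.1 _ _)
  have hbpos : 0 < b :=
    lt_of_le_of_ne hb0 fun h => hne (eq_blockProjection_of_sum_eq_zero hψ hS hZ h.symm)
  have hbT : ∑ i, ∑ j, ψ i * ψ j * Z (1, i) (0, j) = b := by
    rw [hb, sum_comm]
    exact sum_congr rfl fun i _ => sum_congr rfl fun j _ => by
      rw [hsymm hZ.1, mul_comm (ψ _)]
  have htr := trace_blocks (by simpa using hZ.2.2.1)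
  have hA : (Z.submatrix (Prod.mk 0) (Prod.mk 0) : Matrix ι ι ℝ).PosSemidef := hZ.1.submatrix _
  have hC : (Z.submatrix (Prod.mk 1) (Prod.mk 1) : Matrix ι ι ℝ).PosSemidef := hZ.1.submatrix _
  set M : ℝ := 1 / (s * κ) ^ 2 with hM
  have hM0 : 0 < M := by positivity
  have hc0 : 0 ≤ c := by linarith
  -- Since `w i ≤ 2 * s * κ`, one has `M * w i * w j ≤ 4`: the factor 2 between degrees costs a
  -- factor 4 in the gap.
  have hgap' : ∀ y : ι → ℝ, c / 4 * M * ∑ i, ∑ j, w i * w j * (y i - y j) ^ 2 ≤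
      ∑ i, ∑ j, K i j * (y i - y j) ^ 2 := fun y => by
    refine le_trans ?_ (hgap y)
    simp_rw [mul_sum]
    refine sum_le_sum fun i _ => sum_le_sum fun j _ => ?_
    rw [← mul_assoc]
    refine mul_le_mul_of_nonneg_right ?_ (sq_nonneg _)
    have h1 : w i * w j ≤ (s * (2 * κ)) * (s * (2 * κ)) :=
      mul_le_mul (mul_le_mul_of_nonneg_left (hKκ i) hs0.le)
        (mul_le_mul_of_nonneg_left (hKκ j) hs0.le) (hw0 j).le (by positivity)
    calc c / 4 * M * (w i * w j) ≤ c / 4 * M * ((s * (2 * κ)) * (s * (2 * κ))) :=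
          mul_le_mul_of_nonneg_left h1 (by positivity)
      _ = c := by rw [hM]; field_simp; ring
  have gA := laplacian_gap_posSemidef hψ hwψ hK hgap' hA
  have gC := laplacian_gap_posSemidef hψ hwψ hK hgap' hC
  have sA := block_sum_eq hZ ψ 0
  have sC := block_sum_eq hZ ψ 1
  have hkw : ∀ i, degree K i / w i = 1 / s := fun i => by
    have := (hk0 i).ne'; simp only [hw]; field_simp
  have hwS : ∑ i, w i = S := sum_congr rfl fun i _ => hwψ i
  have hψS : ∑ i, ψ i * ψ i = S := sum_congr rfl fun i _ => (sq _).symm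
  have hKB : ∑ i, ∑ j, K i j / (ψ i * ψ j) * Z (0, i) (1, j) ≤ M * b := by
    rw [hb]
    simp_rw [mul_sum]
    refine sum_le_sum fun i _ => sum_le_sum fun j _ => ?_
    rw [← mul_assoc]
    refine mul_le_mul_of_nonneg_right ?_ (hZ.2.1 _ _)
    rw [div_le_iff₀ (mul_pos (hψ i) (hψ j))]
    refine (hK1 i j).trans ?_
    have h1 : (s * κ) * (s * κ) ≤ w i * w j :=
      mul_le_mul (mul_le_mul_of_nonneg_left (hκK i) hs0.le)
        (mul_le_mul_of_nonneg_left (hκK j) hs0.le) (by positivity) (hw0 i).le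
    calc (1 : ℝ) = M * ((s * κ) * (s * κ)) := by rw [hM]; field_simp
      _ ≤ M * (w i * w j) := mul_le_mul_of_nonneg_left h1 hM0.le
      _ = M * (ψ i * ψ j) * (ψ i * ψ j) := by rw [hwψ, hwψ]; ring
  simp only [submatrix_apply, hkw, hwS, hψS, sub_zero, sub_self, ← hb, hbT, ← mul_sum]
    at gA gC sA sC
  rw [sA] at gA
  rw [sC, eq_sub_of_add_eq' htr] at gC
  rw [hval, matInner_symLaplacian_two_block hW hK hφ (hsymm hZ.1), hZ.2.2.1]
  have hB' := mul_le_mul_of_nonneg_left hKB hτ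
  have hpos := mul_pos (mul_pos (sub_pos.mpr hc) hM0) hbpos
  have hdiv : 2 / s = 2 * (1 / s) := by ring
  rw [hdiv]
  push_cast
  linarith

end Recovery

/-! ### Spectral gap and degrees of the Gaussian kernel on a path. -/

theorem sum_consecutive_le_sum_sum (f : ℕ → ℕ → ℝ) (hf : ∀ i j, 0 ≤ f i j) (m : ℕ) :
    ∑ t ∈ range m, (f t (t + 1) + f (t + 1) t) ≤
      ∑ i ∈ range (m + 1), ∑ j ∈ range (m + 1), f i j := by
  induction m with
  | zero => simpa using hf 0 0
  | succ m ih =>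
    rw [sum_range_succ]
    have h1 : f m (m + 1) ≤ ∑ i ∈ range (m + 1), f i (m + 1) :=
      single_le_sum (f := fun i => f i (m + 1)) (fun i _ => hf i _) (self_mem_range_succ m)
    have h2 : f (m + 1) m ≤ ∑ j ∈ range (m + 1), f (m + 1) j :=
      single_le_sum (fun i _ => hf _ i) (self_mem_range_succ m)
    have e : ∑ i ∈ range (m + 1 + 1), ∑ j ∈ range (m + 1 + 1), f i j =
        ∑ i ∈ range (m + 1), ∑ j ∈ range (m + 1), f i j + ∑ i ∈ range (m + 1), f i (m + 1)
          + (∑ j ∈ range (m + 1), f (m + 1) j + f (m + 1) (m + 1)) := by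
      rw [sum_range_succ _ (m + 1), ← sum_add_distrib, ← sum_range_succ]
      simp_rw [← sum_range_succ]
    rw [e]
    linarith [hf (m + 1) (m + 1)]

theorem sum_sum_abs_sub (n : ℕ) :
    ∑ i ∈ range n, ∑ j ∈ range n, |(i : ℝ) - j| = ((n : ℝ) ^ 3 - n) / 3 := by
  induction n with
  | zero => simp
  | succ n ih =>
    have h : ∀ m : ℕ, ∑ i ∈ range m, ((n : ℝ) - i) = m * n - m * (m - 1) / 2 := by
      intro m
      induction m with
      | zero => simp
      | succ m ih => rw [sum_range_succ, ih]; push_cast; ring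
    have h1 : ∑ i ∈ range n, |(n : ℝ) - i| = n * n - n * (n - 1) / 2 := by
      rw [← h]
      refine sum_congr rfl fun i hi => abs_of_nonneg ?_
      have : (i : ℝ) ≤ n := by exact_mod_cast (mem_range.mp hi).le
      linarith
    have h2 : ∑ i ∈ range n, |(i : ℝ) - n| = n * n - n * (n - 1) / 2 := by
      rw [← h1]; exact sum_congr rfl fun i _ => abs_sub_comm _ _
    simp_rw [sum_range_succ, sum_add_distrib, ih, h1, h2]
    push_cast
    simp
    ring

/-- Telescope from `j` to `i` and apply Cauchy–Schwarz to the `|i - j|` increments. -/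
theorem sq_sub_le_abs_mul_sum (y : ℕ → ℝ) {m i j : ℕ} (hi : i ≤ m) (hj : j ≤ m) :
    (y i - y j) ^ 2 ≤ |(i : ℝ) - j| * ∑ t ∈ range m, (y (t + 1) - y t) ^ 2 := by
  wlog h : j ≤ i generalizing i j
  · have := this hj hi (le_of_not_ge h)
    rwa [abs_sub_comm, ← neg_sub, neg_sq] at this
  have e : y i - y j = ∑ t ∈ Ico j i, (y (t + 1) - y t) := (sum_Ico_sub y h).symm
  have hc : ((i : ℝ) - j) = ((Ico j i).card : ℝ) := by rw [Nat.card_Ico, Nat.cast_sub h]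
  rw [e, hc, abs_of_nonneg (Nat.cast_nonneg _)]
  refine sq_sum_le_card_mul_sum_sq.trans (mul_le_mul_of_nonneg_left ?_ (Nat.cast_nonneg _))
  refine sum_le_sum_of_subset_of_nonneg (fun t ht => ?_) fun t _ _ => sq_nonneg _
  rw [mem_Ico] at ht
  exact mem_range.mpr (by omega)

theorem sum_sum_fin_eq_sum_sum_range (f : ℕ → ℕ → ℝ) (n : ℕ) :
    ∑ i : Fin n, ∑ j : Fin n, f i j = ∑ i ∈ range n, ∑ j ∈ range n, f i j := by
  have h : ∀ i, ∑ j : Fin n, f i j = ∑ j ∈ range n, f i j := fun i =>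
    Fin.sum_univ_eq_sum_range (f i) n
  simp_rw [h]
  exact Fin.sum_univ_eq_sum_range (fun i => ∑ j ∈ range n, f i j) n

/-- The one-dimensional Gaussian similarity matrix. -/
noncomputable def gaussianKernel (n : ℕ) (r : ℝ) : Matrix (Fin n) (Fin n) ℝ :=
  Matrix.of fun i j => Real.exp (-(r * ((i : ℝ) - j) ^ 2))

/-- Let `E` be the sum of squared increments of `y`. Keeping only neighbouring pairs, in both
orders, bounds the right side below by `2 * exp (-r) * E`; summing `|i - j| * E` over all pairs
bounds the double sum on the left by `n ^ 3 / 3 * E`. -/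
theorem gaussianKernel_gap {n : ℕ} (hn : 0 < n) (r : ℝ) (y : Fin n → ℝ) :
    6 * Real.exp (-r) / (n : ℝ) ^ 3 * ∑ i, ∑ j, (y i - y j) ^ 2 ≤
      ∑ i, ∑ j, gaussianKernel n r i j * (y i - y j) ^ 2 := by
  obtain ⟨m, rfl⟩ : ∃ m, n = m + 1 := ⟨n - 1, by omega⟩
  set z : ℕ → ℝ := fun t => if h : t < m + 1 then y ⟨t, h⟩ else 0 with hz
  have hyz : ∀ i, y i = z i := fun i => by simp only [hz, dif_pos i.isLt]
  set E := ∑ t ∈ range m, (z (t + 1) - z t) ^ 2 with hE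
  have h1 : ∑ i, ∑ j, (y i - y j) ^ 2 ≤ ((m + 1 : ℕ) : ℝ) ^ 3 / 3 * E := by
    have e : ∑ i, ∑ j, (y i - y j) ^ 2 =
        ∑ i ∈ range (m + 1), ∑ j ∈ range (m + 1), (z i - z j) ^ 2 := by
      simp_rw [hyz, sum_sum_fin_eq_sum_sum_range (fun i j => (z i - z j) ^ 2)]
    calc _ = _ := e
      _ ≤ ∑ i ∈ range (m + 1), ∑ j ∈ range (m + 1), |(i : ℝ) - j| * E :=
        sum_le_sum fun i hi => sum_le_sum fun j hj =>
          sq_sub_le_abs_mul_sum z (Nat.lt_succ_iff.mp (mem_range.mp hi))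
            (Nat.lt_succ_iff.mp (mem_range.mp hj))
      _ = (((m + 1 : ℕ) : ℝ) ^ 3 - (m + 1 : ℕ)) / 3 * E := by
        simp_rw [← sum_mul]; rw [sum_sum_abs_sub]
      _ ≤ _ := by
        refine mul_le_mul_of_nonneg_right ?_ (sum_nonneg fun t _ => sq_nonneg _)
        have : (0 : ℝ) ≤ (m + 1 : ℕ) := Nat.cast_nonneg _
        linarith
  have h2 : 2 * Real.exp (-r) * E ≤ ∑ i, ∑ j, gaussianKernel (m + 1) r i j * (y i - y j) ^ 2 := by
    have e : ∑ i, ∑ j, gaussianKernel (m + 1) r i j * (y i - y j) ^ 2 =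
        ∑ i ∈ range (m + 1), ∑ j ∈ range (m + 1),
          Real.exp (-(r * ((i : ℝ) - j) ^ 2)) * (z i - z j) ^ 2 := by
      rw [← sum_sum_fin_eq_sum_sum_range
        (fun i j => Real.exp (-(r * ((i : ℝ) - j) ^ 2)) * (z i - z j) ^ 2)]
      simp_rw [← hyz]
      rfl
    rw [e]
    refine le_trans (le_of_eq ?_) (sum_consecutive_le_sum_sum
      (fun i j => Real.exp (-(r * ((i : ℝ) - j) ^ 2)) * (z i - z j) ^ 2)
      (fun i j => by positivity) m)
    rw [hE, mul_sum]
    refine sum_congr rfl fun t _ => ?_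
    have e1 : ((t : ℝ) - (t + 1 : ℕ)) ^ 2 = 1 := by push_cast; ring
    have e2 : (((t + 1 : ℕ) : ℝ) - t) ^ 2 = 1 := by push_cast; ring
    rw [e1, e2, mul_one]
    ring
  have hn0 : (0 : ℝ) < ((m + 1 : ℕ) : ℝ) ^ 3 := by positivity
  calc _ ≤ 6 * Real.exp (-r) / ((m + 1 : ℕ) : ℝ) ^ 3 * (((m + 1 : ℕ) : ℝ) ^ 3 / 3 * E) :=
        mul_le_mul_of_nonneg_left h1 (by positivity)
    _ = 2 * Real.exp (-r) * E := by field_simp; ring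
    _ ≤ _ := h2

theorem gaussianKernel_symm {n : ℕ} (r : ℝ) (i j : Fin n) :
    gaussianKernel n r i j = gaussianKernel n r j i := by
  simp only [gaussianKernel, Matrix.of_apply]; congr 3; ring

theorem gaussianKernel_le_one {n : ℕ} {r : ℝ} (hr : 0 ≤ r) (i j : Fin n) :
    gaussianKernel n r i j ≤ 1 :=
  Real.exp_le_one_iff.mpr (by have := mul_nonneg hr (sq_nonneg ((i : ℝ) - j)); linarith)

/-- The left side is the degree of an endpoint. The bijection `f` sends `m` to a vertex at distance
at most `m` from `a`: to `a + m` if it exists, otherwise to `n - 1 - m`. -/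
theorem sum_exp_le_degree_gaussianKernel {n : ℕ} {r : ℝ} (hr : 0 ≤ r) (a : Fin n) :
    ∑ m : Fin n, Real.exp (-(r * (m : ℝ) ^ 2)) ≤ degree (gaussianKernel n r) a := by
  let f : Fin n → Fin n := fun m =>
    if h : (a : ℕ) + m < n then ⟨a + m, h⟩ else ⟨n - 1 - m, by omega⟩
  have hf : f.Injective := by
    intro m m' h
    have := congrArg Fin.val h
    ext
    simp only [f] at this
    split_ifs at this <;> (try dsimp only at this) <;> omega
  have hb : f.Bijective := Finite.injective_iff_bijective.mp hf
  rw [degree, ← hb.sum_comp fun j => gaussianKernel n r a j]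
  refine sum_le_sum fun m _ => Real.exp_le_exp.mpr (neg_le_neg (mul_le_mul_of_nonneg_left ?_ hr))
  refine sq_le_sq' ?_ ?_
  · have : (f m : ℕ) ≤ m + a := by simp only [f]; split_ifs <;> simp <;> omega
    have : ((f m : ℕ) : ℝ) ≤ m + a := by exact_mod_cast this
    linarith
  · have : (a : ℕ) ≤ m + f m := by simp only [f]; split_ifs <;> simp <;> omega
    have : (a : ℝ) ≤ m + (f m : ℕ) := by exact_mod_cast this
    linarith

/-- Vertices on either side of `a` lie at distinct distances, so each side contributes at most one
endpoint degree. The maps `f` (reflection of `0, …, a`) and `g` (cyclic shift by `a`) extend these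
distances to permutations. -/
theorem degree_gaussianKernel_le {n : ℕ} (r : ℝ) (a : Fin n) :
    degree (gaussianKernel n r) a ≤ 2 * ∑ m : Fin n, Real.exp (-(r * (m : ℝ) ^ 2)) := by
  let f : Fin n → Fin n := fun j => if (j : ℕ) ≤ a then ⟨a - j, by omega⟩ else j
  let g : Fin n → Fin n := fun j =>
    if h : (a : ℕ) ≤ j then ⟨j - a, by omega⟩ else ⟨n - a + j, by omega⟩
  have hf : f.Bijective := Finite.injective_iff_bijective.mp fun m m' h => by
    have := congrArg Fin.val h
    ext
    simp only [f] at this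
    split_ifs at this <;> (try dsimp only at this) <;> omega
  have hg : g.Bijective := Finite.injective_iff_bijective.mp fun m m' h => by
    have := congrArg Fin.val h
    ext
    simp only [g] at this
    split_ifs at this <;> (try dsimp only at this) <;> omega
  have h1 := hf.sum_comp fun m : Fin n => Real.exp (-(r * (m : ℝ) ^ 2))
  have h2 := hg.sum_comp fun m : Fin n => Real.exp (-(r * (m : ℝ) ^ 2))
  rw [two_mul]
  nth_rw 1 [← h1]
  rw [← h2, ← sum_add_distrib, degree]
  refine sum_le_sum fun j _ => ?_
  simp only [gaussianKernel, Matrix.of_apply]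
  rcases le_total (j : ℕ) a with h | h
  · have : ((f j : ℕ) : ℝ) = a - j := by simp only [f, if_pos h, Nat.cast_sub h]
    rw [this]
    exact le_add_of_nonneg_right (Real.exp_pos _).le
  · have : ((g j : ℕ) : ℝ) = j - a := by simp only [g, dif_pos h, Nat.cast_sub h]
    rw [this, sub_sq_comm]
    exact le_add_of_nonneg_left (Real.exp_pos _).le

/-! ### Existence of optimal k-means centers. -/

section KMeans

variable {ι κ E : Type*}

theorem exists_forall_sum_norm_sub_sq_le [NormedAddCommGroup E] [InnerProductSpace ℝ E]
    (s : Finset ι) (x : ι → E) :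
    ∃ m, ∀ c, ∑ i ∈ s, ‖x i - m‖ ^ 2 ≤ ∑ i ∈ s, ‖x i - c‖ ^ 2 := by
  rcases s.eq_empty_or_nonempty with rfl | hs
  · exact ⟨0, fun c => by simp⟩
  refine ⟨(s.card : ℝ)⁻¹ • ∑ i ∈ s, x i, fun c => ?_⟩
  set m := (s.card : ℝ)⁻¹ • ∑ i ∈ s, x i with hm
  have hcard : (s.card : ℝ) ≠ 0 := by exact_mod_cast hs.card_pos.ne'
  have h0 : ∑ i ∈ s, (x i - m) = 0 := by
    rw [sum_sub_distrib, sum_const, hm, ← Nat.cast_smul_eq_nsmul ℝ, smul_smul,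
      mul_inv_cancel₀ hcard, one_smul, sub_self]
  have h1 : ∑ i ∈ s, inner ℝ (x i - m) (m - c) = 0 := by
    rw [← sum_inner, h0, inner_zero_left]
  have h2 : ∑ i ∈ s, ‖x i - c‖ ^ 2 =
      ∑ i ∈ s, (‖x i - m‖ ^ 2 + 2 * inner ℝ (x i - m) (m - c) + ‖m - c‖ ^ 2) :=
    sum_congr rfl fun i _ => by rw [← norm_add_sq_real, sub_add_sub_cancel]
  rw [h2, sum_add_distrib, sum_add_distrib, ← mul_sum, h1]
  have : 0 ≤ ∑ i ∈ s, ‖m - c‖ ^ 2 := sum_nonneg fun _ _ => sq_nonneg _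
  linarith

theorem kMeansObjective_le [Fintype ι] [Finite κ] [NormedAddCommGroup E] (x : ι → E) (c : κ → E)
    (s : ι → κ) : kMeansObjective x c ≤ ∑ i, ‖x i - c (s i)‖ ^ 2 :=
  sum_le_sum fun i _ => ciInf_le (Set.finite_range _).bddBelow (s i)

theorem IsNearestCenter.kMeansObjective_eq [Fintype ι] [Finite κ] [NormedAddCommGroup E] {x : ι → E}
    {c : κ → E} {s : ι → κ} (h : IsNearestCenter x c s) :
    kMeansObjective x c = ∑ i, ‖x i - c (s i)‖ ^ 2 := by
  refine le_antisymm (kMeansObjective_le x c s) (sum_le_sum fun i _ => ?_)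
  have : Nonempty κ := ⟨s i⟩
  exact le_ciInf fun a => pow_le_pow_left₀ (norm_nonneg _) (h i a) 2

theorem exists_isNearestCenter [Finite κ] [Nonempty κ] [NormedAddCommGroup E] (x : ι → E)
    (c : κ → E) : ∃ s, IsNearestCenter x c s := by
  choose s hs using fun i => Finite.exists_min fun a => ‖x i - c a‖
  exact ⟨s, hs⟩

/-- Optimal k-means centers exist. -/
theorem exists_isKMeansOptimal [Fintype ι] [Finite κ] [Nonempty κ] [NormedAddCommGroup E]
    [InnerProductSpace ℝ E] (x : ι → E) : ∃ c : κ → E, IsKMeansOptimal x c := by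
  classical
  have := Fintype.ofFinite κ
  have hcost : ∀ (s : ι → κ) (c : κ → E), ∑ i, ‖x i - c (s i)‖ ^ 2 =
      ∑ a, ∑ i with s i = a, ‖x i - c a‖ ^ 2 := fun s c => by
    rw [← sum_fiberwise univ s]
    refine sum_congr rfl fun a _ => sum_congr rfl fun i hi => ?_
    rw [(mem_filter.mp hi).2]
  choose m hm using fun (s : ι → κ) (a : κ) =>
    exists_forall_sum_norm_sub_sq_le (univ.filter fun i => s i = a) x
  -- There are finitely many assignments, so compactness is not needed: take the best assignment
  -- together with its own optimal centers.
  obtain ⟨s₀, hs₀⟩ := Finite.exists_min fun s : ι → κ => ∑ i, ‖x i - m s (s i)‖ ^ 2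
  refine ⟨m s₀, fun c => ?_⟩
  obtain ⟨s, hs⟩ := exists_isNearestCenter x c
  calc kMeansObjective x (m s₀) ≤ ∑ i, ‖x i - m s₀ (s₀ i)‖ ^ 2 := kMeansObjective_le _ _ _
    _ ≤ ∑ i, ‖x i - m s (s i)‖ ^ 2 := hs₀ s
    _ ≤ ∑ i, ‖x i - c (s i)‖ ^ 2 := by
      rw [hcost, hcost]
      exact sum_le_sum fun a _ => hm s a (c a)
    _ = kMeansObjective x c := hs.kMeansObjective_eq.symm

end KMeans

/-! ### Failure of k-means on two parallel lines. -/

/-- From `n` to `n + 2`, the two new outermost terms each equal `n + 1`, and the inner ones are the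
sum for `n`. -/
theorem le_sum_abs_two_mul_sub (n : ℕ) :
    (n : ℝ) * (n - 1) / 2 ≤ ∑ i ∈ range n, |2 * (i : ℝ) - (n - 1)| := by
  induction n using Nat.twoStepInduction with
  | zero => simp
  | one => simp
  | more n ih _ =>
    rw [sum_range_succ, sum_range_succ']
    have e : ∀ i : ℕ, 2 * ((i + 1 : ℕ) : ℝ) - ((n + 2 : ℕ) - 1) = 2 * (i : ℝ) - (n - 1) :=
      fun i => by push_cast; ring
    simp_rw [e]
    have h1 : 2 * (n : ℝ) - (n - 1) = n + 1 := by ring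
    have h2 : 2 * ((0 : ℕ) : ℝ) - ((n + 2 : ℕ) - 1) = -((n : ℝ) + 1) := by push_cast; ring
    rw [h1, h2, abs_neg, abs_of_nonneg (by positivity : (0 : ℝ) ≤ n + 1)]
    push_cast
    linarith

theorem norm_linePoint_sub_sq (n : ℕ) (Δ : ℝ) (p : Fin 2 × Fin n) (c : EuclideanSpace ℝ (Fin 2)) :
    ‖linePoint n Δ p - c‖ ^ 2 = ((if p.1 = 0 then -Δ / 2 else Δ / 2) - c 0) ^ 2
      + ((p.2 : ℝ) / ((n : ℝ) - 1) - c 1) ^ 2 := by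
  rw [EuclideanSpace.real_norm_sq_eq, Fin.sum_univ_two]
  simp [linePoint]

theorem sum_linePoint_sub_half {n : ℕ} (hn : 2 ≤ n) :
    ∑ i : Fin n, ((i : ℝ) / ((n : ℝ) - 1) - 1 / 2) = 0 := by
  have h0 : (n : ℝ) - 1 ≠ 0 := by
    have : (2 : ℝ) ≤ n := by exact_mod_cast hn
    linarith
  have h : ∀ m : ℕ, ∑ i ∈ range m, ((i : ℝ) / ((n : ℝ) - 1) - 1 / 2) =
      m * (m - 1) / 2 / ((n : ℝ) - 1) - m / 2 := by
    intro m
    induction m with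
    | zero => simp
    | succ m ih => rw [sum_range_succ, ih]; push_cast; ring
  rw [Fin.sum_univ_eq_sum_range (fun i => (i : ℝ) / ((n : ℝ) - 1) - 1 / 2), h]
  field_simp
  ring

theorem le_sum_abs_linePoint_sub_half {n : ℕ} (hn : 2 ≤ n) :
    (n : ℝ) / 4 ≤ ∑ i : Fin n, |(i : ℝ) / ((n : ℝ) - 1) - 1 / 2| := by
  have h0 : 0 < (n : ℝ) - 1 := by
    have : (2 : ℝ) ≤ n := by exact_mod_cast hn
    linarith
  rw [Fin.sum_univ_eq_sum_range (fun i => |(i : ℝ) / ((n : ℝ) - 1) - 1 / 2|)]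
  have e : ∀ i : ℕ, |(i : ℝ) / ((n : ℝ) - 1) - 1 / 2| =
      |2 * (i : ℝ) - (n - 1)| / (2 * ((n : ℝ) - 1)) := fun i => by
    have h2 : 0 < 2 * ((n : ℝ) - 1) := by linarith
    conv_rhs => rw [← abs_of_pos h2, ← abs_div]
    congr 1
    field_simp
  simp_rw [e]
  rw [← sum_div, le_div_iff₀ (by linarith)]
  refine le_trans (le_of_eq ?_) (le_sum_abs_two_mul_sub n)
  ring

theorem kMeansFails_linePoint {n : ℕ} (hn : 2 ≤ n) {Δ : ℝ} (hΔ : 0 < Δ) (hΔ' : Δ < 1 / 2) :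
    KMeansFails (linePoint n Δ) (lineLabel n) := by
  refine ⟨exists_isKMeansOptimal _, fun c s hopt hs hsame => ?_⟩
  set t : Fin n → ℝ := fun i => (i : ℝ) / ((n : ℝ) - 1) with ht
  have hn0 : (0 : ℝ) < n := by exact_mod_cast (by omega : 0 < n)
  set V := ∑ i, (t i - 1 / 2) ^ 2 with hV
  have hlow : 2 * V ≤ kMeansObjective (linePoint n Δ) c := by
    rw [hs.kMeansObjective_eq, Fintype.sum_prod_type, Fin.sum_univ_two, two_mul]
    -- All points of a line share one center, of height `y`. Dropping the horizontal part leaves the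
    -- deviation of the heights from `y`, smallest at their mean `1 / 2`.
    have key : ∀ a, V ≤ ∑ i, ‖linePoint n Δ (a, i) - c (s (a, i))‖ ^ 2 := fun a => by
      set y := c (s (a, ⟨0, by omega⟩)) 1 with hy
      have h1 : ∀ i, (t i - 1 / 2) ^ 2 + 2 * (1 / 2 - y) * (t i - 1 / 2) ≤
          ‖linePoint n Δ (a, i) - c (s (a, i))‖ ^ 2 := fun i => by
        have e : s (a, i) = s (a, ⟨0, by omega⟩) := (hsame _ _).mpr rfl
        rw [norm_linePoint_sub_sq, e, ← hy]
        refine le_trans ?_ (le_add_of_nonneg_left (sq_nonneg _))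
        change _ ≤ (t i - y) ^ 2
        linarith [sq_nonneg (1 / 2 - y), (by ring : (t i - y) ^ 2 =
          (t i - 1 / 2) ^ 2 + 2 * (1 / 2 - y) * (t i - 1 / 2) + (1 / 2 - y) ^ 2)]
      have h2 := sum_le_sum fun i (_ : i ∈ univ) => h1 i
      rw [sum_add_distrib, ← mul_sum, sum_linePoint_sub_half hn] at h2
      linarith
    exact add_le_add (key 0) (key 1)
  -- Assigning the lower and upper halves to these centers changes the cost from `2 * V` by at most
  -- `2 * n * (Δ ^ 2 / 4 - 1 / 16)`, since the absolute deviations on each line sum to at least `n /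
  -- 4`.
  have hup : kMeansObjective (linePoint n Δ)
      (fun a : Fin 2 => !₂[0, if a = 0 then 1 / 4 else 3 / 4]) < 2 * V := by
    refine (kMeansObjective_le _ _ fun p => if t p.2 ≤ 1 / 2 then 0 else 1).trans_lt ?_
    have h1 : ∀ p : Fin 2 × Fin n, ‖linePoint n Δ p -
        !₂[0, if (if t p.2 ≤ 1 / 2 then (0 : Fin 2) else 1) = 0 then 1 / 4 else 3 / 4]‖ ^ 2 =
        Δ ^ 2 / 4 + (t p.2 - 1 / 2) ^ 2 - |t p.2 - 1 / 2| / 2 + 1 / 16 := fun p => by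
      rw [norm_linePoint_sub_sq]
      change _ + (t p.2 - _) ^ 2 = _
      have hx : ((if p.1 = 0 then -Δ / 2 else Δ / 2) - 0) ^ 2 = Δ ^ 2 / 4 := by
        split_ifs <;> ring
      rcases le_or_gt (t p.2) (1 / 2) with h | h
      · rw [abs_of_nonpos (by linarith)]
        simp only [if_pos h, if_true, Matrix.cons_val_zero, Matrix.cons_val_one,
          Matrix.cons_val_fin_one, hx]
        ring
      · rw [abs_of_pos (by linarith)]
        simp only [if_neg (not_le.mpr h), one_ne_zero, if_false,
          Matrix.cons_val_zero, Matrix.cons_val_one, Matrix.cons_val_fin_one, hx]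
        ring
    simp_rw [h1]
    have h2 : (n : ℝ) / 4 ≤ ∑ i, |t i - 1 / 2| := le_sum_abs_linePoint_sub_half hn
    have h3 : ∑ i, (Δ ^ 2 / 4 + (t i - 1 / 2) ^ 2 - |t i - 1 / 2| / 2 + 1 / 16) =
        n * (Δ ^ 2 / 4) + V - (∑ i, |t i - 1 / 2|) / 2 + n * (1 / 16) := by
      rw [sum_add_distrib, sum_sub_distrib, sum_add_distrib, sum_div, sum_const, sum_const,
        card_univ, Fintype.card_fin, nsmul_eq_mul, nsmul_eq_mul]
    rw [Fintype.sum_prod_type, Fin.sum_univ_two]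
    simp only [h3]
    have h4 : Δ ^ 2 < 1 / 4 := by nlinarith
    have h5 := mul_lt_mul_of_pos_left h4 hn0
    linarith
  exact absurd (hopt _) (not_le.mpr (hup.trans_le hlow))

/-! ### Specialization to the two lines and the separation condition. -/

theorem sum_cluster_lineLabel {n : ℕ} (a : Fin 2) (f : Fin 2 × Fin n → ℝ) :
    ∑ p ∈ cluster (lineLabel n) a, f p = ∑ i, f (a, i) := by
  rw [cluster, sum_filter, Fintype.sum_prod_type]
  simp only [lineLabel, Fin.sum_univ_two]
  fin_cases a <;> simp

theorem ratioCutPartition_lineLabel (n : ℕ) :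
    ratioCutPartition (lineLabel n) = blockProjection (fun _ : Fin n => (1 : ℝ)) := by
  have hcard : ∀ a : Fin 2, ((cluster (lineLabel n) a).card : ℝ) = n := fun a => by
    rw [card_eq_sum_ones, Nat.cast_sum, sum_cluster_lineLabel]; simp
  ext p q
  simp only [ratioCutPartition, blockProjection, Matrix.of_apply, hcard]
  simp [lineLabel]

theorem nCutPartition_lineLabel {n : ℕ} {W : Matrix (Fin 2 × Fin n) (Fin 2 × Fin n) ℝ}
    {d : Fin n → ℝ} (hd : ∀ i, 0 ≤ d i) (hW : ∀ p, degree W p = d p.2) :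
    nCutPartition W (lineLabel n) = blockProjection (fun i => √(d i)) := by
  ext p q
  simp only [nCutPartition, blockProjection, Matrix.of_apply, sum_cluster_lineLabel, hW,
    Real.sq_sqrt (hd _)]
  rfl

theorem heatKernel_linePoint (n : ℕ) (Δ σ : ℝ) (p q : Fin 2 × Fin n) :
    heatKernel (linePoint n Δ) σ p q =
      (if p.1 = q.1 then 1 else Real.exp (-(Δ ^ 2 / (2 * σ ^ 2)))) *
        gaussianKernel n (1 / (((n : ℝ) - 1) ^ 2 * (2 * σ ^ 2))) p.2 q.2 := by
  simp only [heatKernel, gaussianKernel, Matrix.of_apply, norm_linePoint_sub_sq]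
  obtain ⟨a, i⟩ := p
  obtain ⟨b, j⟩ := q
  rcases eq_or_ne a b with rfl | hab
  · simp only [if_true, one_mul, linePoint, PiLp.toLp_apply, Matrix.cons_val_zero,
      Matrix.cons_val_one, Matrix.cons_val_fin_one]
    congr 1
    generalize (n : ℝ) - 1 = m
    ring
  · have hx : ((if a = 0 then -Δ / 2 else Δ / 2) - (if b = 0 then -Δ / 2 else Δ / 2)) ^ 2
        = Δ ^ 2 := by
      split_ifs with h h'
      · exact absurd (h.trans h'.symm) hab
      · ring
      · ring
      · omega
    simp only [if_neg hab, linePoint, PiLp.toLp_apply, Matrix.cons_val_zero,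
      Matrix.cons_val_one, Matrix.cons_val_fin_one, hx]
    rw [← Real.exp_add]
    congr 1
    generalize (n : ℝ) - 1 = m
    ring

/-- Exact recovery for two parallel lines whose interaction is small compared with the weight of
neighbouring points. -/
theorem sdpRecovers_linePoint {n : ℕ} (hn : 0 < n) {Δ σ : ℝ}
    (hτ : Real.exp (-(Δ ^ 2 / (2 * σ ^ 2))) * (n : ℝ) ^ 3 ≤
      Real.exp (-(1 / (((n : ℝ) - 1) ^ 2 * (2 * σ ^ 2))))) :
    RatioCutSDPRecovers (heatKernel (linePoint n Δ) σ) (lineLabel n) ∧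
      NCutSDPRecovers (heatKernel (linePoint n Δ) σ) (lineLabel n) := by
  have : Nonempty (Fin n) := ⟨⟨0, hn⟩⟩
  have hW := heatKernel_linePoint n Δ σ
  have hr : 0 ≤ 1 / (((n : ℝ) - 1) ^ 2 * (2 * σ ^ 2)) := by positivity
  set r := 1 / (((n : ℝ) - 1) ^ 2 * (2 * σ ^ 2))
  set τ := Real.exp (-(Δ ^ 2 / (2 * σ ^ 2)))
  have hτ0 : 0 < τ := Real.exp_pos _
  have hn3 : (0 : ℝ) < (n : ℝ) ^ 3 := by positivity
  -- As `τ > 0`, this yields both strict inequalities `3 * τ < c` and `4 * τ < c`.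
  have hc : 6 * τ ≤ 6 * Real.exp (-r) / (n : ℝ) ^ 3 := by
    rw [le_div_iff₀ hn3, mul_assoc]
    exact mul_le_mul_of_nonneg_left hτ (by norm_num)
  have hsymm := gaussianKernel_symm (n := n) r
  have hpos : ∀ i j, 0 ≤ gaussianKernel n r i j := fun i j => (Real.exp_pos _).le
  have hone := gaussianKernel_le_one (n := n) hr
  constructor
  · rw [RatioCutSDPRecovers, ratioCutPartition_lineLabel, Fintype.card_fin]
    exact ratioCut_unique_minimizer hW hsymm hpos hone hτ0.le (by linarith)
      (gaussianKernel_gap hn r)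
  · have hd : ∀ i, 0 ≤ (1 + τ) * degree (gaussianKernel n r) i := fun i =>
      mul_nonneg (by positivity) (sum_nonneg fun j _ => hpos i j)
    rw [NCutSDPRecovers, nCutPartition_lineLabel hd (degree_two_block hW), Fintype.card_fin]
    exact nCut_unique_minimizer hW hsymm hone hτ0.le (by linarith)
      (sum_pos (fun m _ => Real.exp_pos _) univ_nonempty)
      (sum_exp_le_degree_gaussianKernel hr) (degree_gaussianKernel_le r)
      (gaussianKernel_gap hn r)

/-- After taking logarithms the claim is `Δ² / (2σ²) ≥ r + 3 log n`: under the root in `hΔ`, the `1`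
produces `r` and the `6γ` term produces `3 log n`. The bound `n ≥ 4 > π` makes `log (n / π)`
positive. -/
theorem exp_separation_mul_cube_le {n : ℕ} (hn : 4 ≤ n) {Δ γ σ : ℝ} (hγ : 0 < γ)
    (hσ : σ ^ 2 = γ / (((n : ℝ) - 1) ^ 2 * Real.log ((n : ℝ) / Real.pi)))
    (hΔ : 1 / ((n : ℝ) - 1) *
      √(1 + 6 * γ * Real.log (n : ℝ) / Real.log ((n : ℝ) / Real.pi)) ≤ Δ) :
    Real.exp (-(Δ ^ 2 / (2 * σ ^ 2))) * (n : ℝ) ^ 3 ≤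
      Real.exp (-(1 / (((n : ℝ) - 1) ^ 2 * (2 * σ ^ 2)))) := by
  have hn4 : (4 : ℝ) ≤ n := by exact_mod_cast hn
  have hlog : 0 < Real.log ((n : ℝ) / Real.pi) :=
    Real.log_pos ((one_lt_div Real.pi_pos).mpr (Real.pi_lt_four.trans_le hn4))
  have hlogn : 0 ≤ Real.log (n : ℝ) := Real.log_nonneg (by linarith)
  set ℓ := Real.log ((n : ℝ) / Real.pi)
  have hn1 : 0 < (n : ℝ) - 1 := by linarith
  have hin : 0 ≤ 1 + 6 * γ * Real.log (n : ℝ) / ℓ := by positivity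
  have hsq : (1 + 6 * γ * Real.log (n : ℝ) / ℓ) / ((n : ℝ) - 1) ^ 2 ≤ Δ ^ 2 := by
    have h := pow_le_pow_left₀ (by positivity) hΔ 2
    rw [mul_pow, Real.sq_sqrt hin] at h
    rwa [div_pow, one_pow, one_div_mul_eq_div] at h
  have hσ0 : 0 < 2 * σ ^ 2 := by rw [hσ]; positivity
  have hmain : 1 / (((n : ℝ) - 1) ^ 2 * (2 * σ ^ 2)) + 3 * Real.log n ≤ Δ ^ 2 / (2 * σ ^ 2) := by
    refine le_trans (le_of_eq ?_) (div_le_div_of_nonneg_right hsq hσ0.le)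
    rw [hσ]
    field_simp
    ring
  have hcube : (n : ℝ) ^ 3 = Real.exp (3 * Real.log n) := by
    rw [mul_comm, Real.exp_mul, Real.exp_log (by linarith)]
    norm_cast
  rw [hcube, ← Real.exp_add, Real.exp_le_exp]
  linarith

end SpectralSDP

theorem theorem4 (n : ℕ) (hn : 4 ≤ n) (Δ : ℝ) (hΔ : 0 < Δ) :
    (∀ γ σ : ℝ, 0 < γ →
      σ ^ 2 = γ / (((n : ℝ) - 1) ^ 2 * Real.log ((n : ℝ) / Real.pi)) →
      1 / ((n : ℝ) - 1) *
          Real.sqrt (1 + 6 * γ * Real.log (n : ℝ) / Real.log ((n : ℝ) / Real.pi)) ≤ Δ →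
      SpectralSDP.RatioCutSDPRecovers
          (SpectralSDP.heatKernel (SpectralSDP.linePoint n Δ) σ) (SpectralSDP.lineLabel n) ∧
        SpectralSDP.NCutSDPRecovers
          (SpectralSDP.heatKernel (SpectralSDP.linePoint n Δ) σ) (SpectralSDP.lineLabel n)) ∧
    (Δ < 1 / 2 →
      SpectralSDP.KMeansFails (SpectralSDP.linePoint n Δ) (SpectralSDP.lineLabel n)) :=
  ⟨fun _ _ hγ hσ hsep => SpectralSDP.sdpRecovers_linePoint (by omega)
    (SpectralSDP.exp_separation_mul_cube_le hn hγ hσ hsep),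
    SpectralSDP.kMeansFails_linePoint (by omega) hΔ⟩
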